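/- Let $n\ge 0$ and let $\mathcal S_n$ be the symmetric group on $\underline n=\{1,\dots,n\}$. Let $L\mathcal P_k(n)$ be the $\mathbb Q$-vector space with basis the $k$-element subsets of $\underline n$, on which $\mathcal S_n$ acts by $\pi\cdot A=\pi(A)$. For $A\subseteq\underline n$ with $|A|=i\le k$ put $$\sigma_k^n(A)=\sum_{B\subseteq \underline n\setminus A,\ |B|=k-i}A\sqcup B\in L\mathcal P_k(n),$$ and let $F_iL\mathcal P_k(n)$ be the $\mathcal S_n$-submodule spanned by all $\sigma_k^n(A)$ with $|A|=i$. For a partition $\lambda$ of $n$ let $V_\lambda$ be the irreducible $\mathbb Q[\mathcal S_n]$-module indexed by $\lambda$, i.e. the span of the polytabloids of shape $\lambda$ in the permutation module on the tabloids of shape $\lambda$; here $(n-0,0)$ means $(n)$. **Proposition 2.6.** Let $0\le i\le k\le n/2$. The $\mathcal S_n$-modules $V_{(n)},V_{(n-1,1)},\dots,V_{(n-k,k)}$ are irreducible and pairwise non-isomorphic, and there are isomorphisms of $\mathcal S_n$-modules $$L\mathcal P_k(n)\cong V_{(n)}\oplus V_{(n-1,1)}\oplus\dots\oplus V_{(n-k,k)},\qquad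 F_iL\mathcal P_k(n)\cong V_{(n)}\oplus V_{(n-1,1)}\oplus\dots\oplus V_{(n-i,i)}.$$ In particular every summand occurs with multiplicity one. -/

import Mathlib

open scoped Pointwise DirectSum

noncomputable section

namespace PowerSetRep

/-- The `ℚ`-linearization of a set `X` with an action of a group `G`: the vector space with
basis `X`, on which `G` permutes the basis vectors. -/
def linearization (G X : Type) [Group G] [MulAction G X] : Representation ℚ G (X →₀ ℚ) where
  toFun g := Finsupp.lmapDomain ℚ ℚ (g • ·)
  map_one' := by ext; simp
  map_mul' g h := by ext; simp [mul_smul]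

theorem linearization_single {G X : Type} [Group G] [MulAction G X] (g : G) (x : X) (a : ℚ) :
    linearization G X g (Finsupp.single x a) = Finsupp.single (g • x) a := by
  simp [linearization]

/-- The subrepresentation spanned by a set `S` of vectors that is stable under the group. -/
def spanSubrep {G V : Type} [Group G] [AddCommGroup V] [Module ℚ V] (ρ : Representation ℚ G V)
    (S : Set V) (hS : ∀ g, ∀ w ∈ S, ρ g w ∈ S) : Subrepresentation ρ where
  toSubmodule := Submodule.span ℚ S
  apply_mem_toSubmodule g _ hv :=
    (Submodule.span_le (p := (Submodule.span ℚ S).comap (ρ g))).2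
      (fun w hw => Submodule.subset_span (hS g w hw)) hv

/-! ### Power sets -/

/-- The representation of `S_n` on the `ℚ`-span of the power set of an `n`-element set,
with `π · A = π(A)`. -/
abbrev LPow (n : ℕ) : Representation ℚ (Equiv.Perm (Fin n)) (Finset (Fin n) →₀ ℚ) :=
  linearization (Equiv.Perm (Fin n)) (Finset (Fin n))

/-- The span `LP_k(n)` of the `k`-element subsets. -/
def LP (n k : ℕ) : Subrepresentation (LPow n) :=
  spanSubrep (LPow n) {v | ∃ A : Finset (Fin n), A.card = k ∧ v = Finsupp.single A 1} (by
    rintro g _ ⟨A, hA, rfl⟩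
    exact ⟨g • A, by simpa using hA, linearization_single g A 1⟩)

/-- `σ_k^n(A) = ∑_B A ⊔ B`, over the subsets `B` of the complement of `A` that have
`k - card A` elements; only used for `card A ≤ k`. -/
def sigma (n k : ℕ) (A : Finset (Fin n)) : Finset (Fin n) →₀ ℚ :=
  ∑ B ∈ Finset.powersetCard (k - A.card) Aᶜ, Finsupp.single (A ∪ B) 1

theorem linearization_sigma (n k : ℕ) (g : Equiv.Perm (Fin n)) (A : Finset (Fin n)) :
    LPow n g (sigma n k A) = sigma n k (g • A) := by
  have hc : (g • A)ᶜ = g • Aᶜ := by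
    ext x
    rw [Finset.mem_compl, ← Finset.inv_smul_mem_iff, ← Finset.inv_smul_mem_iff, Finset.mem_compl]
  unfold sigma
  rw [map_sum, hc, Finset.card_smul_finset]
  refine Finset.sum_bij (fun B _ => g • B) ?_ ?_ ?_ ?_
  · intro B hB
    rw [Finset.mem_powersetCard] at hB ⊢
    exact ⟨Finset.smul_finset_subset_smul_finset hB.1, by simpa using hB.2⟩
  · intro B _ C _ h
    exact smul_left_cancel g h
  · intro C hC
    rw [Finset.mem_powersetCard] at hC
    refine ⟨g⁻¹ • C, ?_, by simp⟩
    rw [Finset.mem_powersetCard]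
    refine ⟨?_, by simpa using hC.2⟩
    have := Finset.smul_finset_subset_smul_finset (a := g⁻¹) hC.1
    simpa using this
  · intro B _
    rw [linearization_single, Finset.smul_finset_union]

/-- The piece `F_i LP_k(n)` of the canonical filtration: the span of the `σ_k^n(A)` with
`card A = i`. -/
def F (n k i : ℕ) : Subrepresentation (LPow n) :=
  spanSubrep (LPow n) {v | ∃ A : Finset (Fin n), A.card = i ∧ v = sigma n k A} (by
    rintro g _ ⟨A, hA, rfl⟩
    exact ⟨g • A, by simpa using hA, linearization_sigma n k g A⟩)

/-- `F_i LP_k(n)` is contained in `LP_k(n)`. -/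
theorem F_le_LP (n : ℕ) {k i : ℕ} (hik : i ≤ k) : F n k i ≤ LP n k := by
  change Submodule.span ℚ _ ≤ Submodule.span ℚ _
  rw [Submodule.span_le]
  rintro _ ⟨A, hA, rfl⟩
  refine Submodule.sum_mem _ fun B hB => Submodule.subset_span ⟨A ∪ B, ?_, rfl⟩
  rw [Finset.mem_powersetCard] at hB
  rw [Finset.card_union_of_disjoint (Finset.disjoint_left.2 fun x hx hx' =>
    (Finset.mem_compl.1 (hB.1 hx')) hx)]
  omega

/-! ### The irreducible representations `V_μ` -/

/-- Tableaux of shape `μ`: bijective fillings of the cells `(row, column)` of `μ` with the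
numbers of `Fin n`. -/
abbrev Tableau (n : ℕ) (μ : YoungDiagram) : Type := μ.cells ≃ Fin n

/-- Tabloids of shape `μ` (row equivalence classes of tableaux), given by the function that
sends each entry to the index of its row. -/
def Tabloid (n : ℕ) (μ : YoungDiagram) : Type :=
  {f : Fin n → ℕ // ∀ r, (Finset.univ.filter fun x => f x = r).card = μ.rowLen r}

/-- `S_n` permutes the entries of tabloids. -/
instance (n : ℕ) (μ : YoungDiagram) : MulAction (Equiv.Perm (Fin n)) (Tabloid n μ) where
  smul g f := ⟨fun x => f.1 (g⁻¹ x), fun r => by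
    rw [← f.2 r]
    refine Finset.card_bij (fun x _ => g⁻¹ x) ?_ ?_ ?_
    · intro x hx
      simpa using hx
    · intro x _ y _ h
      exact g⁻¹.injective h
    · intro y hy
      exact ⟨g y, by simpa using hy, by simp⟩⟩
  one_smul _ := rfl
  mul_smul g h f := Subtype.ext (funext fun x => by
    change f.1 ((g * h)⁻¹ x) = f.1 (h⁻¹ (g⁻¹ x))
    rw [mul_inv_rev, Equiv.Perm.mul_apply])

namespace Tableau

variable {n : ℕ} {μ : YoungDiagram}

/-- The row of the entry `x`. -/
def row (T : Tableau n μ) (x : Fin n) : ℕ := (T.symm x).1.1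

/-- The column of the entry `x`. -/
def col (T : Tableau n μ) (x : Fin n) : ℕ := (T.symm x).1.2

/-- The tabloid `{T}`. -/
def tabloid (T : Tableau n μ) : Tabloid n μ := ⟨T.row, fun r => by
  rw [YoungDiagram.rowLen_eq_card]
  refine Finset.card_bij (fun x _ => (T.symm x).1) ?_ ?_ ?_
  · intro x hx
    rw [YoungDiagram.mem_row_iff]
    exact ⟨(YoungDiagram.mem_cells _).1 (T.symm x).2, (Finset.mem_filter.1 hx).2⟩
  · intro x _ y _ h
    exact T.symm.injective (Subtype.ext h)
  · intro c hc
    rw [YoungDiagram.mem_row_iff] at hc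
    exact ⟨T ⟨c, (YoungDiagram.mem_cells _).2 hc.1⟩, Finset.mem_filter.2
      ⟨Finset.mem_univ _, by simpa [row] using hc.2⟩, by simp⟩⟩

/-- The column stabilizer of `T`. -/
def colStab (T : Tableau n μ) : Finset (Equiv.Perm (Fin n)) :=
  Finset.univ.filter fun g => ∀ x, T.col (g x) = T.col x

/-- The polytabloid `e_T = ∑ sgn(π) π{T}`, over the column stabilizer of `T`. -/
def polytabloid (T : Tableau n μ) : Tabloid n μ →₀ ℚ :=
  ∑ g ∈ T.colStab, Finsupp.single (g • T.tabloid) ((Equiv.Perm.sign g : ℤ) : ℚ)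

theorem linearization_polytabloid (T : Tableau n μ) (g : Equiv.Perm (Fin n)) :
    linearization (Equiv.Perm (Fin n)) (Tabloid n μ) g T.polytabloid =
      polytabloid (T.trans g : Tableau n μ) := by
  have hcol : ∀ x, col (T.trans g : Tableau n μ) x = T.col (g⁻¹ x) := fun _ => rfl
  have htab : tabloid (T.trans g : Tableau n μ) = g • T.tabloid := rfl
  unfold polytabloid
  rw [map_sum]
  refine Finset.sum_bij (fun h _ => g * h * g⁻¹) ?_ ?_ ?_ ?_
  · intro h hh
    simp only [colStab, Finset.mem_filter, Finset.mem_univ, true_and, hcol] at hh ⊢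
    intro x
    simpa using hh (g⁻¹ x)
  · intro a _ b _ h
    simpa using h
  · intro h hh
    simp only [colStab, Finset.mem_filter, Finset.mem_univ, true_and, hcol] at hh ⊢
    refine ⟨g⁻¹ * h * g, fun x => ?_, by group⟩
    simpa using hh (g x)
  · intro h _
    rw [linearization_single, htab, smul_smul, smul_smul]
    congr 1
    · congr 1
      group
    · rw [Equiv.Perm.sign_mul, Equiv.Perm.sign_mul, Equiv.Perm.sign_inv, mul_right_comm,
        Int.units_mul_self, one_mul]

end Tableau

/-- The representation `V_μ` of `S_n` for a partition `μ` of `n`: the span of the polytabloids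
of shape `μ` in the linearization of the set of tabloids of shape `μ`. -/
def specht (n : ℕ) (μ : YoungDiagram) :
    Subrepresentation (linearization (Equiv.Perm (Fin n)) (Tabloid n μ)) :=
  spanSubrep _ (Set.range fun T : Tableau n μ => T.polytabloid) (by
    rintro g _ ⟨T, rfl⟩
    exact ⟨T.trans g, (T.linearization_polytabloid g).symm⟩)

/-- The partition `(n - j, j)` of `n`, for `j ≤ n / 2` (it is `(n)` for `j = 0`). -/
def twoRow (n j : ℕ) (h : 2 * j ≤ n) : YoungDiagram :=
  YoungDiagram.ofRowLens [n - j, j] (by simp [List.sortedGE_iff_pairwise]; omega)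

/-- `(n - j, j)` has `n` cells. -/
theorem twoRow_card (n j : ℕ) (h : 2 * j ≤ n) : (twoRow n j h).card = n := by
  simp only [twoRow, YoungDiagram.ofRowLens, YoungDiagram.card, YoungDiagram.cellsOfRowLens]
  rw [Finset.card_union_of_disjoint]
  · simp
    omega
  · rw [Finset.disjoint_left]
    simp

/-- The representation `V_{(n-j,j)}` of `S_n`, for `j ≤ n / 2`. -/
abbrev V (n j : ℕ) (h : 2 * j ≤ n) :
    Representation ℚ (Equiv.Perm (Fin n)) (specht n (twoRow n j h)).toSubmodule :=
  (specht n (twoRow n j h)).toRepresentation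

/-- The external direct sum `V_{(n)} ⊕ V_{(n-1,1)} ⊕ … ⊕ V_{(n-m,m)}`, for `m ≤ n / 2`. -/
abbrev sumV (n m : ℕ) (h : 2 * m ≤ n) :
    Representation ℚ (Equiv.Perm (Fin n))
      (⨁ j : Fin (m + 1), (specht n (twoRow n j.1 (by omega))).toSubmodule) :=
  Representation.directSum fun j : Fin (m + 1) => V n j.1 (by omega)

end PowerSetRep

end

noncomputable section

namespace PowerSetRep

open Equiv (Perm swap)

/-! ### Signed sums over subgroups of the symmetric group -/

section Antisymmetrizer

variable {n : ℕ} {M N : Type} [AddCommGroup M] [Module ℚ M] [AddCommGroup N] [Module ℚ N]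

open Classical in
/-- The action of `∑ sgn(g) g`, over a subgroup `H` of the symmetric group. -/
def antisymmetrizer (ρ : Representation ℚ (Perm (Fin n)) M) (H : Subgroup (Perm (Fin n))) :
    M →ₗ[ℚ] M :=
  ∑ g : Perm (Fin n), if g ∈ H then ((Perm.sign g : ℤ) : ℚ) • ρ g else 0

variable (ρ : Representation ℚ (Perm (Fin n)) M) (H : Subgroup (Perm (Fin n)))

open Classical in
theorem antisymmetrizer_apply (v : M) :
    antisymmetrizer ρ H v =
      ∑ g : Perm (Fin n), if g ∈ H then ((Perm.sign g : ℤ) : ℚ) • ρ g v else 0 := by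
  rw [antisymmetrizer, LinearMap.sum_apply]
  refine Finset.sum_congr rfl fun g _ => ?_
  split_ifs <;> simp

theorem antisymmetrizer_mem {L : Submodule ℚ M} (hL : ∀ g, ∀ v ∈ L, ρ g v ∈ L) {v : M}
    (hv : v ∈ L) : antisymmetrizer ρ H v ∈ L := by
  classical
  rw [antisymmetrizer_apply]
  refine Submodule.sum_mem _ fun g _ => ?_
  split_ifs
  · exact L.smul_mem _ (hL g v hv)
  · exact L.zero_mem

theorem antisymmetrizer_apply_of_mem {s : Perm (Fin n)} (hs : s ∈ H) (v : M) :
    antisymmetrizer ρ H (ρ s v) = ((Perm.sign s : ℤ) : ℚ) • antisymmetrizer ρ H v := by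
  classical
  rw [antisymmetrizer_apply, antisymmetrizer_apply, Finset.smul_sum]
  refine Fintype.sum_equiv (Equiv.mulRight s) _ _ fun g => ?_
  simp only [Equiv.coe_mulRight, H.mul_mem_cancel_right hs]
  split_ifs
  · rw [smul_smul, Perm.sign_mul, map_mul]
    have : ((Perm.sign s : ℤ) : ℚ) * ((Perm.sign s : ℤ) : ℚ) = 1 := by
      exact_mod_cast Int.units_coe_mul_self _
    push_cast
    rw [mul_comm ((Perm.sign g : ℤ) : ℚ), ← mul_assoc, this, one_mul]
    rfl
  · simp

theorem antisymmetrizer_eq_zero {x y : Fin n} (hxy : x ≠ y) (hs : swap x y ∈ H) {v : M}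
    (hv : ρ (swap x y) v = v) : antisymmetrizer ρ H v = 0 := by
  have h := antisymmetrizer_apply_of_mem ρ H hs v
  rw [hv, Perm.sign_swap hxy] at h
  have h2 : (2 : ℚ) • antisymmetrizer ρ H v = 0 := by
    rw [two_smul, ← eq_neg_iff_add_eq_zero]
    simpa using h
  exact (smul_eq_zero.1 h2).resolve_left two_ne_zero

theorem antisymmetrizer_comm {h : Perm (Fin n)} (hh : ∀ g ∈ H, Commute h g) (v : M) :
    ρ h (antisymmetrizer ρ H v) = antisymmetrizer ρ H (ρ h v) := by
  classical
  rw [antisymmetrizer_apply, antisymmetrizer_apply, map_sum]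
  refine Finset.sum_congr rfl fun g _ => ?_
  split_ifs with hg
  · rw [map_smul, ← Module.End.mul_apply, ← Module.End.mul_apply, ← map_mul, ← map_mul,
      (hh g hg).eq]
  · simp

theorem map_antisymmetrizer {ρ} {τ : Representation ℚ (Perm (Fin n)) N} {f : M →ₗ[ℚ] N}
    (hf : ∀ g v, f (ρ g v) = τ g (f v)) (v : M) :
    f (antisymmetrizer ρ H v) = antisymmetrizer τ H (f v) := by
  classical
  rw [antisymmetrizer_apply, antisymmetrizer_apply, map_sum]
  refine Finset.sum_congr rfl fun g _ => ?_
  split_ifs <;> simp [hf]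

theorem antisymmetrizer_bot (v : M) : antisymmetrizer ρ ⊥ v = v := by
  classical
  rw [antisymmetrizer_apply, Finset.sum_eq_single 1]
  · simp
  · intro g _ hg
    simp [hg]
  · simp

/-- If `H'` is the union of `H` and its coset by a transposition `s`, then the signed sum over
`H'` is the one over `H` times `1 - s`. -/
theorem antisymmetrizer_of_coset {H H' : Subgroup (Perm (Fin n))} {x y : Fin n} (hxy : x ≠ y)
    (hle : H ≤ H') (hs' : swap x y ∈ H') (hs : swap x y ∉ H)
    (hc : ∀ g ∈ H', g ∈ H ∨ g * swap x y ∈ H) (v : M) :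
    antisymmetrizer ρ H' v = antisymmetrizer ρ H (v - ρ (swap x y) v) := by
  classical
  have h1 : antisymmetrizer ρ H (ρ (swap x y) v) = ∑ g : Perm (Fin n),
      if g * swap x y ∈ H then (-((Perm.sign g : ℤ) : ℚ)) • ρ g v else 0 := by
    rw [antisymmetrizer_apply]
    refine Fintype.sum_equiv (Equiv.mulRight (swap x y)) _ _ fun g => ?_
    simp only [Equiv.coe_mulRight, Equiv.mul_swap_mul_self]
    split_ifs
    · rw [Perm.sign_mul, Perm.sign_swap hxy, map_mul]
      simp
    · rfl
  rw [map_sub, h1, antisymmetrizer_apply, antisymmetrizer_apply, ← Finset.sum_sub_distrib]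
  refine Finset.sum_congr rfl fun g _ => ?_
  by_cases hg : g ∈ H
  · have : g * swap x y ∉ H := fun h => hs ((H.mul_mem_cancel_left hg).1 h)
    simp [hg, hle hg, this]
  · by_cases hg' : g * swap x y ∈ H
    · have : g ∈ H' := (H'.mul_mem_cancel_right hs').1 (hle hg')
      simp [hg, hg', this]
    · have : g ∉ H' := fun h => (hc g h).elim hg hg'
      simp [hg, hg', this]

end Antisymmetrizer

/-! ### The standard inner product -/

theorem linearization_apply_apply {G X : Type} [Group G] [MulAction G X] (g : G) (v : X →₀ ℚ)
    (x : X) : linearization G X g v x = v (g⁻¹ • x) := by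
  have := Finsupp.mapDomain_apply (MulAction.injective g) v (g⁻¹ • x)
  rw [smul_inv_smul] at this
  exact this

theorem sum_linearization_mul {G X : Type} [Group G] [MulAction G X] [Fintype X] (g : G)
    (v w : X →₀ ℚ) :
    ∑ x, linearization G X g v x * w x = ∑ x, v x * linearization G X g⁻¹ w x := by
  simp only [linearization_apply_apply]
  exact Fintype.sum_equiv (MulAction.toPerm g⁻¹) _ _ fun x => by simp

theorem sum_antisymmetrizer_mul {n : ℕ} {X : Type} [MulAction (Perm (Fin n)) X] [Fintype X]
    (H : Subgroup (Perm (Fin n))) (v w : X →₀ ℚ) :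
    ∑ x, antisymmetrizer (linearization _ X) H v x * w x =
      ∑ x, v x * antisymmetrizer (linearization _ X) H w x := by
  classical
  simp only [antisymmetrizer_apply, Finsupp.finsetSum_apply, Finset.sum_mul, Finset.mul_sum]
  rw [Finset.sum_comm, Finset.sum_comm (s := (Finset.univ : Finset X))]
  refine Fintype.sum_equiv (Equiv.inv _) _ _ fun g => ?_
  simp only [Equiv.inv_apply, inv_mem_iff]
  split_ifs
  · simp only [Finsupp.smul_apply, smul_eq_mul, Perm.sign_inv, mul_assoc, ← Finset.mul_sum,
      mul_left_comm _ ((Perm.sign g : ℤ) : ℚ), sum_linearization_mul]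
  · simp

/-! ### The maps induced by `sigma` -/

section UpMap

variable (n k : ℕ)

/-- The linear map sending the basis vector of `A` to `σ_k^n(A)`. -/
def upMap : (Finset (Fin n) →₀ ℚ) →ₗ[ℚ] (Finset (Fin n) →₀ ℚ) :=
  Finsupp.linearCombination ℚ (sigma n k)

variable {n k}

@[simp]
theorem upMap_single (A : Finset (Fin n)) (c : ℚ) :
    upMap n k (Finsupp.single A c) = c • sigma n k A := by
  simp [upMap]

theorem upMap_LPow (g : Perm (Fin n)) (v : Finset (Fin n) →₀ ℚ) :
    upMap n k (LPow n g v) = LPow n g (upMap n k v) := by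
  induction v using Finsupp.induction_linear with
  | zero => simp
  | add v w hv hw => simp only [map_add, hv, hw]
  | single A c => rw [linearization_single, upMap_single, upMap_single, map_smul,
      linearization_sigma]

theorem sigma_apply {A : Finset (Fin n)} (hA : A.card ≤ k) (B : Finset (Fin n)) :
    sigma n k A B = if A ⊆ B ∧ B.card = k then 1 else 0 := by
  rw [sigma, Finsupp.finsetSum_apply]
  simp only [Finsupp.single_apply]
  split_ifs with h
  · rw [Finset.sum_eq_single (B \ A)]
    · rw [if_pos (Finset.union_sdiff_of_subset h.1)]
    · intro C hC hne
      rw [Finset.mem_powersetCard] at hC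
      refine if_neg fun hB => hne ?_
      rw [← hB, Finset.union_sdiff_cancel_left]
      exact Finset.disjoint_left.2 fun x hx hx' => (Finset.mem_compl.1 (hC.1 hx')) hx
    · intro hn
      refine absurd ?_ hn
      rw [Finset.mem_powersetCard, Finset.card_sdiff_of_subset h.1, h.2]
      exact ⟨fun x hx => Finset.mem_compl.2 (Finset.mem_sdiff.1 hx).2, rfl⟩
  · refine Finset.sum_eq_zero fun C hC => if_neg ?_
    rintro rfl
    rw [Finset.mem_powersetCard] at hC
    refine h ⟨Finset.subset_union_left, ?_⟩
    rw [Finset.card_union_of_disjoint (Finset.disjoint_left.2 fun x hx hx' =>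
      (Finset.mem_compl.1 (hC.1 hx')) hx)]
    omega

theorem sigma_self {A : Finset (Fin n)} (hA : A.card = k) : sigma n k A = Finsupp.single A 1 := by
  subst hA
  simp [sigma]

theorem sigma_succ {A : Finset (Fin n)} (hA : A.card = k) :
    sigma n (k + 1) A = ∑ x ∈ Aᶜ, Finsupp.single (insert x A) 1 := by
  subst hA
  simp [sigma, Finset.powersetCard_one, Finset.union_singleton]

theorem upMap_sigma_succ {A : Finset (Fin n)} {i : ℕ} (hA : A.card = i) (hik : i + 1 ≤ k) :
    upMap n k (sigma n (i + 1) A) = ((k - i : ℕ) : ℚ) • sigma n k A := by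
  rw [sigma_succ hA, map_sum]
  ext B
  simp only [upMap_single, one_smul, Finsupp.finsetSum_apply, Finsupp.smul_apply, smul_eq_mul]
  rw [Finset.sum_congr rfl fun x hx => sigma_apply (k := k) (A := insert x A)
    (by rw [Finset.card_insert_of_notMem (Finset.mem_compl.1 hx)]; omega) B,
    sigma_apply (by omega)]
  split_ifs with h
  · rw [← Finset.sum_filter, Finset.sum_const, nsmul_eq_mul, ← hA, ← h.2,
      ← Finset.card_sdiff_of_subset h.1]
    congr 3
    ext x
    simp only [Finset.mem_filter, Finset.mem_compl, Finset.mem_sdiff, Finset.insert_subset_iff]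
    tauto
  · rw [mul_zero]
    refine Finset.sum_eq_zero fun x _ => if_neg fun hx => h ⟨?_, hx.2⟩
    exact (Finset.subset_insert _ _).trans hx.1

theorem F_eq_map (i : ℕ) :
    (F n k i).toSubmodule = (LP n i).toSubmodule.map (upMap n k) := by
  change Submodule.span ℚ _ = (Submodule.span ℚ _).map _
  rw [Submodule.map_span]
  congr 1
  ext v
  constructor
  · rintro ⟨A, hA, rfl⟩
    exact ⟨_, ⟨A, hA, rfl⟩, by simp⟩
  · rintro ⟨_, ⟨A, hA, rfl⟩, rfl⟩
    exact ⟨A, hA, by simp⟩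

theorem F_self : (F n k k).toSubmodule = (LP n k).toSubmodule := by
  change Submodule.span ℚ _ = Submodule.span ℚ _
  congr 1
  ext v
  refine exists_congr fun A => and_congr_right fun hA => ?_
  rw [sigma_self hA]

theorem map_upMap_F_succ {i : ℕ} (hik : i + 1 ≤ k) :
    (F n (i + 1) i).toSubmodule.map (upMap n k) ≤ (F n k i).toSubmodule := by
  rw [Submodule.map_le_iff_le_comap]
  change Submodule.span ℚ _ ≤ _
  rw [Submodule.span_le]
  rintro _ ⟨A, hA, rfl⟩
  change upMap n k _ ∈ Submodule.span ℚ _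
  rw [upMap_sigma_succ hA hik]
  exact Submodule.smul_mem _ _ (Submodule.subset_span ⟨A, hA, rfl⟩)

theorem F_le_F_succ {i : ℕ} (hik : i + 1 ≤ k) :
    (F n k i).toSubmodule ≤ (F n k (i + 1)).toSubmodule := by
  rw [F_eq_map (i + 1)]
  change Submodule.span ℚ _ ≤ _
  rw [Submodule.span_le]
  rintro _ ⟨A, hA, rfl⟩
  refine ⟨((k - i : ℕ) : ℚ)⁻¹ • sigma n (i + 1) A, ?_, ?_⟩
  · exact Submodule.smul_mem _ _
      (F_le_LP n (Nat.le_succ i) (Submodule.subset_span ⟨A, hA, rfl⟩))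
  · rw [map_smul, upMap_sigma_succ hA hik, smul_smul, inv_mul_cancel₀, one_smul]
    exact_mod_cast Nat.sub_ne_zero_of_lt hik

theorem F_mono {i j : ℕ} (hij : i ≤ j) (hjk : j ≤ k) :
    (F n k i).toSubmodule ≤ (F n k j).toSubmodule := by
  induction j, hij using Nat.le_induction with
  | base => exact le_rfl
  | succ j _ ih => exact (ih (by omega)).trans (F_le_F_succ hjk)

end UpMap

theorem single_mem_LP {n k : ℕ} {A : Finset (Fin n)} (hA : A.card = k) :
    Finsupp.single A 1 ∈ (LP n k).toSubmodule :=
  Submodule.subset_span ⟨A, hA, rfl⟩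

theorem swap_smul_of_mem_iff {n : ℕ} {x y : Fin n} {A : Finset (Fin n)} (h : x ∈ A ↔ y ∈ A) :
    swap x y • A = A := by
  ext z
  rw [← Finset.inv_smul_mem_iff, Equiv.swap_inv, Perm.smul_def]
  rcases eq_or_ne z x with rfl | hx
  · rw [Equiv.swap_apply_left, h]
  rcases eq_or_ne z y with rfl | hy
  · rw [Equiv.swap_apply_right, h]
  rw [Equiv.swap_apply_of_ne_of_ne hx hy]

theorem swap_smul_eq_insert_erase {n : ℕ} {x y : Fin n} {A : Finset (Fin n)} (hx : x ∈ A)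
    (hy : y ∉ A) : swap x y • A = insert y (A.erase x) := by
  have hxy : x ≠ y := fun h => hy (h ▸ hx)
  ext z
  rw [← Finset.inv_smul_mem_iff, Equiv.swap_inv, Perm.smul_def, Finset.mem_insert,
    Finset.mem_erase]
  rcases eq_or_ne z x with rfl | hzx
  · simp [hy, hxy]
  rcases eq_or_ne z y with rfl | hzy
  · simp [hx]
  simp [Equiv.swap_apply_of_ne_of_ne hzx hzy, hzx, hzy]

/-- The columns of a tableau with two rows: `a r` and `b r` are the entries of the `r`-th column
of length two, and the remaining columns have length one. -/
structure Pairing (n k : ℕ) where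
  col : Fin n → ℕ
  a : Fin k → Fin n
  b : Fin k → Fin n
  col_a : ∀ r, col (a r) = r
  col_b : ∀ r, col (b r) = r
  a_ne_b : ∀ r, a r ≠ b r
  eq_or_eq : ∀ {x r}, col x = (r : Fin k).1 → x = a r ∨ x = b r

namespace Pairing

variable {n k : ℕ} (p : Pairing n k)

theorem a_injective : Function.Injective p.a := fun r s h =>
  Fin.ext (by rw [← p.col_a, h, p.col_a])

theorem b_injective : Function.Injective p.b := fun r s h =>
  Fin.ext (by rw [← p.col_b, h, p.col_b])

theorem a_ne_b' (r s : Fin k) : p.a r ≠ p.b s := fun h => by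
  have : r = s := Fin.ext (by rw [← p.col_a, h, p.col_b])
  exact p.a_ne_b r (by rw [h, this])

/-- The permutations that preserve the columns and fix all entries outside of the first `m`
columns. -/
def colGroup (m : ℕ) : Subgroup (Perm (Fin n)) where
  carrier := {g | ∀ x, p.col (g x) = p.col x ∧ (m ≤ p.col x → g x = x)}
  one_mem' x := ⟨rfl, fun _ => rfl⟩
  mul_mem' {g h} hg hh x := by
    refine ⟨by rw [Perm.mul_apply, (hg _).1, (hh _).1], fun hx => ?_⟩
    rw [Perm.mul_apply, (hh x).2 hx, (hg x).2 hx]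
  inv_mem' {g} hg x := by
    have hx' : g (g⁻¹ x) = x := g.apply_symm_apply x
    have h : p.col (g⁻¹ x) = p.col x := by
      conv_rhs => rw [← hx', (hg _).1]
    refine ⟨h, fun hx => ?_⟩
    have := (hg (g⁻¹ x)).2 (h ▸ hx)
    exact this.symm.trans hx'

variable {p}

theorem mem_colGroup {m : ℕ} {g : Perm (Fin n)} :
    g ∈ p.colGroup m ↔ ∀ x, p.col (g x) = p.col x ∧ (m ≤ p.col x → g x = x) :=
  Iff.rfl

theorem apply_eq_of_mem {m : ℕ} {g : Perm (Fin n)} (hg : g ∈ p.colGroup m) {x : Fin n} {r : Fin k}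
    (hx : p.col x = r) : g x = p.a r ∨ g x = p.b r :=
  p.eq_or_eq (((mem_colGroup.1 hg) x).1.trans hx)

theorem swap_mem {m : ℕ} {r : Fin k} (hr : r.1 < m) : swap (p.a r) (p.b r) ∈ p.colGroup m := by
  intro x
  rcases eq_or_ne x (p.a r) with rfl | hxa
  · rw [Equiv.swap_apply_left, p.col_a, p.col_b]
    exact ⟨rfl, fun h => by omega⟩
  rcases eq_or_ne x (p.b r) with rfl | hxb
  · rw [Equiv.swap_apply_right, p.col_a, p.col_b]
    exact ⟨rfl, fun h => by omega⟩
  rw [Equiv.swap_apply_of_ne_of_ne hxa hxb]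
  exact ⟨rfl, fun _ => rfl⟩

theorem colGroup_zero : p.colGroup 0 = ⊥ := by
  rw [eq_bot_iff]
  intro g hg
  exact Subgroup.mem_bot.2 (Equiv.ext fun x => (hg x).2 (Nat.zero_le _))

theorem colGroup_le_succ (m : ℕ) : p.colGroup m ≤ p.colGroup (m + 1) :=
  fun _ hg x => ⟨(hg x).1, fun hx => (hg x).2 (by omega)⟩

theorem mem_or_mul_swap_mem {r : Fin k} {g : Perm (Fin n)} (hg : g ∈ p.colGroup (r.1 + 1)) :
    g ∈ p.colGroup r ∨ g * swap (p.a r) (p.b r) ∈ p.colGroup r := by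
  have key : ∀ g ∈ p.colGroup (r.1 + 1), g (p.a r) = p.a r → g ∈ p.colGroup r := by
    intro g hg ha x
    refine ⟨(hg x).1, fun hx => ?_⟩
    rcases hx.eq_or_lt with h | h
    · rcases p.eq_or_eq h.symm with rfl | rfl
      · exact ha
      · refine (apply_eq_of_mem hg (p.col_b r)).resolve_left fun h' => ?_
        exact p.a_ne_b r (g.injective (ha.trans h'.symm))
    · exact (hg x).2 h
  rcases apply_eq_of_mem hg (p.col_a r) with h | h
  · exact Or.inl (key g hg h)
  · refine Or.inr (key _ (mul_mem hg (swap_mem (Nat.lt_succ_self _))) ?_)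
    rw [Perm.mul_apply, Equiv.swap_apply_left]
    refine (apply_eq_of_mem hg (p.col_b r)).resolve_right fun h' => ?_
    exact p.a_ne_b r (g.injective (h.trans h'.symm))

theorem commute_of_mem {m : ℕ} (hm : m ≤ k) {g h : Perm (Fin n)} (hg : g ∈ p.colGroup m)
    (ha : ∀ r : Fin k, r.1 < m → h (p.a r) = p.a r)
    (hb : ∀ r : Fin k, r.1 < m → h (p.b r) = p.b r) : Commute h g := by
  refine Perm.Disjoint.commute fun x => ?_
  by_cases hx : m ≤ p.col x
  · exact Or.inr ((hg x).2 hx)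
  · left
    rw [not_le] at hx
    rcases p.eq_or_eq (r := ⟨p.col x, by omega⟩) rfl with h' | h'
    · rw [h']; exact ha _ hx
    · rw [h']; exact hb _ hx

variable (p)

/-- The signed sum over the group of the first `m` columns, acting on the span of the
power set. -/
def kappa (m : ℕ) : (Finset (Fin n) →₀ ℚ) →ₗ[ℚ] (Finset (Fin n) →₀ ℚ) :=
  antisymmetrizer (LPow n) (p.colGroup m)

theorem kappa_succ (r : Fin k) (v : Finset (Fin n) →₀ ℚ) :
    p.kappa (r + 1) v = p.kappa r (v - LPow n (swap (p.a r) (p.b r)) v) := by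
  refine antisymmetrizer_of_coset (LPow n) (p.a_ne_b r) (colGroup_le_succ _)
    (swap_mem (Nat.lt_succ_self _)) (fun h => ?_) (fun g => mem_or_mul_swap_mem) v
  have := (h (p.a r)).2 (p.col_a r).ge
  rw [Equiv.swap_apply_left] at this
  exact p.a_ne_b r this.symm

theorem kappa_single_eq_zero {m : ℕ} {r : Fin k} (hr : r.1 < m) {A : Finset (Fin n)}
    (h : p.a r ∈ A ↔ p.b r ∈ A) : p.kappa m (Finsupp.single A 1) = 0 := by
  refine antisymmetrizer_eq_zero _ _ (p.a_ne_b r) (swap_mem hr) ?_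
  rw [linearization_single, swap_smul_of_mem_iff h]

/-- The entries of the second row. -/
def bottom : Finset (Fin n) := Finset.univ.image p.b

theorem card_bottom : p.bottom.card = k := by
  rw [bottom, Finset.card_image_of_injective _ p.b_injective, Finset.card_univ, Fintype.card_fin]

/-- The image of the polytabloid in the span of the power set. -/
def poly : Finset (Fin n) →₀ ℚ := p.kappa k (Finsupp.single p.bottom 1)

/-- The image of the Specht module in the span of the power set. -/
def spechtImage : Submodule ℚ (Finset (Fin n) →₀ ℚ) :=
  Submodule.span ℚ (Set.range fun g => LPow n g p.poly)

theorem LPow_mem_spechtImage (g : Perm (Fin n)) {v : Finset (Fin n) →₀ ℚ}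
    (hv : v ∈ p.spechtImage) : LPow n g v ∈ p.spechtImage := by
  refine (Submodule.span_le (p := p.spechtImage.comap (LPow n g))).2 ?_ hv
  rintro _ ⟨h, rfl⟩
  refine Submodule.subset_span ⟨g * h, ?_⟩
  simp only [map_mul, Module.End.mul_apply]

theorem spechtImage_le {N : Submodule ℚ (Finset (Fin n) →₀ ℚ)}
    (hN : ∀ g, ∀ v ∈ N, LPow n g v ∈ N) (h : p.poly ∈ N) : p.spechtImage ≤ N := by
  refine Submodule.span_le.2 ?_
  rintro _ ⟨g, rfl⟩
  exact hN g _ h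

theorem poly_mem_spechtImage : p.poly ∈ p.spechtImage :=
  Submodule.subset_span ⟨1, by simp⟩

theorem spechtImage_le_LP : p.spechtImage ≤ (LP n k).toSubmodule :=
  p.spechtImage_le (LP n k).apply_mem_toSubmodule
    (antisymmetrizer_mem _ _ (LP n k).apply_mem_toSubmodule (single_mem_LP p.card_bottom))

/-! ### The signed column sum on subsets of size at most `k` -/

theorem kappa_transversal (R : Finset (Fin k)) :
    p.kappa k (Finsupp.single (Finset.univ.image fun r => if r ∈ R then p.a r else p.b r) 1) ∈
      Submodule.span ℚ {p.poly} := by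
  induction R using Finset.induction_on with
  | empty =>
    simp only [Finset.notMem_empty, if_false]
    exact Submodule.mem_span_singleton_self _
  | insert s R hs ih =>
    have h : (Finset.univ.image fun r => if r ∈ insert s R then p.a r else p.b r) =
        swap (p.a s) (p.b s) • Finset.univ.image fun r => if r ∈ R then p.a r else p.b r := by
      rw [Finset.smul_finset_def, Finset.image_image]
      refine Finset.image_congr fun r _ => ?_
      simp only [Function.comp, Perm.smul_def, Finset.mem_insert]
      rcases eq_or_ne r s with rfl | hrs
      · simp [hs]
      · have h1 := p.a_injective.ne hrs
        have h2 := p.b_injective.ne hrs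
        split_ifs with h3 h4 h4
        · rw [Equiv.swap_apply_of_ne_of_ne h1 (p.a_ne_b' _ _)]
        · exact absurd (h3.resolve_left hrs) h4
        · exact absurd (Or.inr h4) h3
        · rw [Equiv.swap_apply_of_ne_of_ne (p.a_ne_b' _ _).symm h2]
    rw [h, ← linearization_single, kappa, antisymmetrizer_apply_of_mem _ _ (swap_mem s.2)]
    exact Submodule.smul_mem _ _ ih

theorem card_transversal (R : Finset (Fin k)) :
    (Finset.univ.image fun r => if r ∈ R then p.a r else p.b r).card = k := by
  rw [Finset.card_image_of_injective, Finset.card_univ, Fintype.card_fin]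
  intro r s hrs
  have hc : ∀ r, p.col (if r ∈ R then p.a r else p.b r) = r := fun r => by
    split_ifs
    · exact p.col_a r
    · exact p.col_b r
  exact Fin.ext (by rw [← hc r, ← hc s]; exact congrArg _ hrs)

theorem eq_transversal {A : Finset (Fin n)} (hA : A.card ≤ k)
    (h : ∀ r, ¬ (p.a r ∈ A ↔ p.b r ∈ A)) :
    A = Finset.univ.image fun r => if r ∈ (Finset.univ.filter fun r => p.a r ∈ A)
      then p.a r else p.b r := by
  symm
  simp only [Finset.mem_filter, Finset.mem_univ, true_and]
  refine Finset.eq_of_subset_of_card_le ?_ ?_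
  · intro x hx
    obtain ⟨r, -, rfl⟩ := Finset.mem_image.1 hx
    have := h r
    split_ifs with h' <;> tauto
  · rw [← p.card_transversal (Finset.univ.filter fun r => p.a r ∈ A)] at hA
    simpa using hA

theorem kappa_mem_span {v : Finset (Fin n) →₀ ℚ} (hv : v ∈ (LP n k).toSubmodule) :
    p.kappa k v ∈ Submodule.span ℚ {p.poly} := by
  refine (Submodule.span_le (p := (Submodule.span ℚ {p.poly}).comap (p.kappa k))).2 ?_ hv
  rintro _ ⟨A, hA, rfl⟩
  change p.kappa k _ ∈ Submodule.span ℚ _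
  by_cases h : ∃ r, p.a r ∈ A ↔ p.b r ∈ A
  · obtain ⟨r, hr⟩ := h
    rw [p.kappa_single_eq_zero r.2 hr]
    exact Submodule.zero_mem _
  · rw [p.eq_transversal hA.le (not_exists.1 h)]
    exact p.kappa_transversal _

theorem kappa_eq_zero {j : ℕ} (hj : j < k) {v : Finset (Fin n) →₀ ℚ}
    (hv : v ∈ (LP n j).toSubmodule) : p.kappa k v = 0 := by
  refine (Submodule.span_le (p := LinearMap.ker (p.kappa k))).2 ?_ hv
  rintro _ ⟨A, hA, rfl⟩
  change p.kappa k _ = 0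
  by_cases h : ∃ r, p.a r ∈ A ↔ p.b r ∈ A
  · obtain ⟨r, hr⟩ := h
    exact p.kappa_single_eq_zero r.2 hr
  · exfalso
    have := p.eq_transversal (hA.trans_lt hj).le (not_exists.1 h)
    rw [this, p.card_transversal] at hA
    omega

theorem eq_zero_of_kappa {v : Finset (Fin n) →₀ ℚ} (hv : v ∈ p.spechtImage)
    (h : ∀ g, p.kappa k (LPow n g v) = 0) : v = 0 := by
  have key : ∀ w ∈ p.spechtImage, ∑ A, w A * v A = 0 := by
    intro w hw
    induction hw using Submodule.span_induction with
    | mem w hw =>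
      obtain ⟨g, rfl⟩ := hw
      simp only
      rw [sum_linearization_mul, poly, kappa, sum_antisymmetrizer_mul]
      have := h g⁻¹
      rw [kappa] at this
      simp [this]
    | zero => simp
    | add w w' _ _ hw hw' => simp [add_mul, Finset.sum_add_distrib, hw, hw']
    | smul c w _ hw => simp [mul_assoc, ← Finset.mul_sum, hw]
  ext A
  have := (Finset.sum_eq_zero_iff_of_nonneg fun A _ => mul_self_nonneg (v A)).1 (key v hv) A
    (Finset.mem_univ A)
  simpa using this

/-- Every nonzero submodule of the Specht module is the whole Specht module. -/
theorem spechtImage_le_of_ne_zero {N : Submodule ℚ (Finset (Fin n) →₀ ℚ)}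
    (hN : ∀ g, ∀ v ∈ N, LPow n g v ∈ N) {v : Finset (Fin n) →₀ ℚ} (hvN : v ∈ N)
    (hv : v ∈ p.spechtImage) (h0 : v ≠ 0) : p.spechtImage ≤ N := by
  have : ∃ g, p.kappa k (LPow n g v) ≠ 0 := by
    by_contra! h
    exact h0 (p.eq_zero_of_kappa hv h)
  obtain ⟨g, hg⟩ := this
  refine p.spechtImage_le hN ?_
  obtain ⟨c, hc⟩ := Submodule.mem_span_singleton.1
    (p.kappa_mem_span (p.spechtImage_le_LP (p.LPow_mem_spechtImage g hv)))
  have hc0 : c ≠ 0 := by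
    rintro rfl
    exact hg (by rw [← hc, zero_smul])
  rw [← inv_smul_smul₀ hc0 p.poly, hc]
  exact N.smul_mem _ (antisymmetrizer_mem _ _ hN (hN g v hvN))

theorem upMap_poly_ne_zero {l : ℕ} (hkl : k ≤ l) (hl : l + k ≤ n) : upMap n l p.poly ≠ 0 := by
  classical
  obtain ⟨C, hBC, hC, hCl⟩ := Finset.exists_subsuperset_card_eq (s := p.bottom)
    (t := (Finset.univ.image p.a)ᶜ) (n := l) (by
      intro x hx
      obtain ⟨r, -, rfl⟩ := Finset.mem_image.1 hx
      simp [p.a_ne_b']) (by rwa [p.card_bottom]) (by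
      rw [Finset.card_compl, Finset.card_image_of_injective _ p.a_injective, Finset.card_univ,
        Fintype.card_fin, Fintype.card_fin]
      omega)
  have haC : ∀ r, p.a r ∉ C := fun r h => by simpa using hC h
  have hbC : ∀ r, p.b r ∈ C := fun r => hBC (Finset.mem_image_of_mem _ (Finset.mem_univ r))
  have hone : ∀ g ∈ p.colGroup k, g • p.bottom ⊆ C → g = 1 := by
    intro g hg hgC
    have hb : ∀ r, g (p.b r) = p.b r := fun r => by
      refine (apply_eq_of_mem hg (p.col_b r)).resolve_left fun h => haC r ?_
      rw [← h]
      exact hgC (Finset.smul_mem_smul_finset (Finset.mem_image_of_mem _ (Finset.mem_univ r)))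
    have ha : ∀ r, g (p.a r) = p.a r := fun r =>
      (apply_eq_of_mem hg (p.col_a r)).resolve_right fun h =>
        p.a_ne_b r (g.injective (h.trans (hb r).symm))
    ext x
    by_cases hx : k ≤ p.col x
    · rw [(hg x).2 hx, Perm.one_apply]
    · rcases p.eq_or_eq (r := ⟨p.col x, by omega⟩) rfl with h' | h'
      · rw [h', ha, Perm.one_apply]
      · rw [h', hb, Perm.one_apply]
  intro h
  have h1 : upMap n l p.poly C = 1 := by
    rw [poly, kappa, map_antisymmetrizer _ upMap_LPow, antisymmetrizer_apply,
      Finsupp.finsetSum_apply, Finset.sum_eq_single 1]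
    · simp [sigma_apply (p.card_bottom.trans_le hkl), hBC, hCl]
    · intro g _ hg
      split_ifs with hgH
      · rw [upMap_single, one_smul, linearization_sigma, Finsupp.smul_apply,
          sigma_apply (by rw [Finset.card_smul_finset, p.card_bottom]; exact hkl),
          if_neg fun h => hg (hone g hgH h.1), smul_zero]
      · rfl
    · simp
  rw [h] at h1
  simp at h1

theorem upMap_injOn {l : ℕ} (hkl : k ≤ l) (hl : l + k ≤ n) {v : Finset (Fin n) →₀ ℚ}
    (hv : v ∈ p.spechtImage) (h : upMap n l v = 0) : v = 0 := by
  by_contra h0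
  refine p.upMap_poly_ne_zero hkl hl ?_
  exact p.spechtImage_le_of_ne_zero (N := LinearMap.ker (upMap n l))
    (fun g v hv => by
      rw [LinearMap.mem_ker] at hv ⊢
      rw [upMap_LPow, hv, map_zero]) h hv h0 p.poly_mem_spechtImage

theorem poly_ne_zero (hk : 2 * k ≤ n) : p.poly ≠ 0 := fun h =>
  p.upMap_poly_ne_zero le_rfl (by omega) (by rw [h, map_zero])

end Pairing

namespace Pairing

variable {n k : ℕ} (p : Pairing n k)

/-- Some permutation moves `x` and `y` to the column `r` and fixes the earlier columns. -/
theorem exists_perm {r : Fin k} {x y : Fin n} (hxy : x ≠ y)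
    (hx : ∀ s < r, x ≠ p.a s ∧ x ≠ p.b s) (hy : ∀ s < r, y ≠ p.a s ∧ y ≠ p.b s) :
    ∃ h : Perm (Fin n), h x = p.b r ∧ h y = p.a r ∧
      ∀ s < r, h (p.a s) = p.a s ∧ h (p.b s) = p.b s := by
  set y' := swap x (p.b r) y with hy'
  have h1 : ∀ s < r, swap x (p.b r) (p.a s) = p.a s ∧ swap x (p.b r) (p.b s) = p.b s :=
    fun s hs => ⟨Equiv.swap_apply_of_ne_of_ne (hx s hs).1.symm (p.a_ne_b' _ _),
      Equiv.swap_apply_of_ne_of_ne (hx s hs).2.symm (p.b_injective.ne hs.ne)⟩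
  have h2 : ∀ s < r, y' ≠ p.a s ∧ y' ≠ p.b s := fun s hs =>
    ⟨fun h => (hy s hs).1 ((swap x (p.b r)).injective (h.trans (h1 s hs).1.symm)),
      fun h => (hy s hs).2 ((swap x (p.b r)).injective (h.trans (h1 s hs).2.symm))⟩
  have h3 : y' ≠ p.b r := fun h => hxy ((swap x (p.b r)).injective
    ((Equiv.swap_apply_left _ _).trans h.symm))
  refine ⟨swap y' (p.a r) * swap x (p.b r), ?_, ?_, fun s hs => ⟨?_, ?_⟩⟩
  · rw [Perm.mul_apply, Equiv.swap_apply_left,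
      Equiv.swap_apply_of_ne_of_ne h3.symm (p.a_ne_b r).symm]
  · rw [Perm.mul_apply, ← hy', Equiv.swap_apply_left]
  · rw [Perm.mul_apply, (h1 s hs).1,
      Equiv.swap_apply_of_ne_of_ne (h2 s hs).1.symm (p.a_injective.ne hs.ne)]
  · rw [Perm.mul_apply, (h1 s hs).2,
      Equiv.swap_apply_of_ne_of_ne (h2 s hs).2.symm (p.a_ne_b' _ _).symm]

variable {N : Submodule ℚ (Finset (Fin n) →₀ ℚ)}

theorem kappa_sub_mem (hN : ∀ g, ∀ v ∈ N, LPow n g v ∈ N) {r : Fin k}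
    (ih : ∀ A : Finset (Fin n), A.card = k → (∀ s ≤ r, p.a s ∉ A ∧ p.b s ∈ A) →
      p.kappa (r + 1) (Finsupp.single A 1) ∈ N)
    {A : Finset (Fin n)} (hA : A.card = k) (hAr : ∀ s < r, p.a s ∉ A ∧ p.b s ∈ A) {x y : Fin n}
    (hxA : x ∈ A) (hyA : y ∉ A) (hx : ∀ s < r, x ≠ p.b s) (hy : ∀ s < r, y ≠ p.a s) :
    p.kappa r (Finsupp.single A 1) - p.kappa r (Finsupp.single (swap x y • A) 1) ∈ N := by
  obtain ⟨h, hhx, hhy, hh⟩ := p.exists_perm (r := r) (x := x) (y := y)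
    (fun h => hyA (h ▸ hxA)) (fun s hs => ⟨fun h => (hAr s hs).1 (h ▸ hxA), hx s hs⟩)
    (fun s hs => ⟨hy s hs, fun h => hyA (h ▸ (hAr s hs).2)⟩)
  have hsw : swap (p.a r) (p.b r) * h = h * swap x y := by
    rw [← hhx, ← hhy, Equiv.swap_comm, Equiv.swap_apply_apply, inv_mul_cancel_right]
  have hmem : ∀ z, h z ∈ h • A ↔ z ∈ A := fun z => Finset.smul_mem_smul_finset_iff h
  have h1 := ih (h • A) (by rw [Finset.card_smul_finset, hA]) fun s hs => by
    rcases hs.eq_or_lt with rfl | hs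
    · rw [← hhx, ← hhy, hmem, hmem]
      exact ⟨hyA, hxA⟩
    · rw [← (hh s hs).1, ← (hh s hs).2, hmem, hmem]
      exact hAr s hs
  rw [kappa_succ, ← linearization_single, ← Module.End.mul_apply, ← map_mul, hsw, map_mul,
    Module.End.mul_apply, ← map_sub, kappa, ← antisymmetrizer_comm _ _ fun g hg =>
      commute_of_mem r.2.le hg (fun s hs => (hh s hs).1) (fun s hs => (hh s hs).2)] at h1
  have h2 := hN h⁻¹ _ h1
  rw [← Module.End.mul_apply, ← map_mul, inv_mul_cancel, map_one, Module.End.one_apply,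
    map_sub, linearization_single] at h2
  exact h2

/-- Modulo the `σ_k^n(A)` with `card A + 1 = k` and the polytabloid, the signed sum over the first
`m` columns kills the `k`-subsets that meet these columns exactly in the second row. -/
theorem kappa_single_mem (hN : ∀ g, ∀ v ∈ N, LPow n g v ∈ N)
    (hU : ∀ A : Finset (Fin n), A.card + 1 = k → sigma n k A ∈ N)
    (hp : p.poly ∈ N) {m : ℕ} (hm : m ≤ k) :
    ∀ A : Finset (Fin n), A.card = k → (∀ s : Fin k, s.1 < m → p.a s ∉ A ∧ p.b s ∈ A) →
      p.kappa m (Finsupp.single A 1) ∈ N := by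
  induction hm using Nat.decreasingInduction with
  | self =>
    intro A hA h
    have : p.bottom = A := by
      refine Finset.eq_of_subset_of_card_le ?_ (by rw [hA, p.card_bottom])
      intro x hx
      obtain ⟨r, -, rfl⟩ := Finset.mem_image.1 hx
      exact (h r r.2).2
    rwa [← this]
  | of_succ m hm ih =>
    intro A hA hAm
    set r : Fin k := ⟨m, hm⟩
    obtain ⟨x, hxA, hx⟩ : ∃ x ∈ A, x ∉ (Finset.univ.filter fun s => s < r).image p.b := by
      by_contra! h
      have h1 := (Finset.card_le_card h).trans Finset.card_image_le
      have h2 : (Finset.univ.filter fun s => s < r).card = m := by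
        simp [r, Finset.filter_gt_eq_Iio]
      omega
    have hx' : ∀ s < r, x ≠ p.b s := fun s hs h =>
      hx (Finset.mem_image.2 ⟨s, by simpa using hs, h.symm⟩)
    have hcard : (A.erase x).card + 1 = k := by rw [Finset.card_erase_add_one hxA, hA]
    have hsum := antisymmetrizer_mem (LPow n) (p.colGroup m) hN (hU _ hcard)
    have hsigma := sigma_succ (A := A.erase x) rfl
    rw [hcard] at hsigma
    rw [hsigma, map_sum] at hsum
    change ∑ y ∈ (A.erase x)ᶜ, p.kappa m (Finsupp.single (insert y (A.erase x)) 1) ∈ N at hsum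
    have hterm : ∀ y ∈ (A.erase x)ᶜ, (if y ∈ (Finset.univ.filter fun s => s < r).image p.a then 0
        else p.kappa m (Finsupp.single A 1)) -
          p.kappa m (Finsupp.single (insert y (A.erase x)) 1) ∈ N := by
      intro y hy
      rw [Finset.mem_compl, Finset.mem_erase] at hy
      split_ifs with hya
      · obtain ⟨s, hs, rfl⟩ := Finset.mem_image.1 hya
        have hs' : s < r := by simpa using hs
        rw [p.kappa_single_eq_zero (m := m) (r := s) hs', sub_zero]
        · exact N.zero_mem
        · have : p.b s ∈ A.erase x := Finset.mem_erase.2 ⟨(hx' s hs').symm, (hAm s hs').2⟩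
          simp [this]
      · rcases eq_or_ne y x with rfl | hyx
        · rw [Finset.insert_erase hxA, sub_self]
          exact N.zero_mem
        · have hyA : y ∉ A := fun h => hy ⟨hyx, h⟩
          rw [← swap_smul_eq_insert_erase hxA hyA]
          refine p.kappa_sub_mem hN (r := r) (fun B hB hBr => ih B hB fun s hs => ?_) hA
            (fun s hs => hAm s hs) hxA hyA hx' fun s hs h => ?_
          · exact hBr s (Nat.lt_succ_iff.1 hs)
          · exact hya (Finset.mem_image.2 ⟨s, by simpa using hs, h.symm⟩)
    have htot := N.add_mem (N.sum_mem hterm) hsum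
    rw [← Finset.sum_add_distrib] at htot
    simp only [sub_add_cancel] at htot
    rw [Finset.sum_ite, Finset.sum_const_zero, zero_add, Finset.sum_const,
      ← Nat.cast_smul_eq_nsmul ℚ] at htot
    refine (N.smul_mem_iff ?_).1 htot
    rw [Nat.cast_ne_zero, ← Nat.pos_iff_ne_zero, Finset.card_pos]
    refine ⟨x, Finset.mem_filter.2 ⟨by simp, fun h => ?_⟩⟩
    obtain ⟨s, hs, rfl⟩ := Finset.mem_image.1 h
    have hs' : s < r := by simpa using hs
    exact (hAm s hs').1 hxA

/-- The span of the `k`-subsets is generated, as a representation, by the `σ_k^n(A)` with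
`card A + 1 = k` and the polytabloid. -/
theorem LP_le (hN : ∀ g, ∀ v ∈ N, LPow n g v ∈ N)
    (hU : ∀ A : Finset (Fin n), A.card + 1 = k → sigma n k A ∈ N)
    (hp : p.poly ∈ N) : (LP n k).toSubmodule ≤ N := by
  refine Submodule.span_le.2 ?_
  rintro _ ⟨A, hA, rfl⟩
  have := p.kappa_single_mem hN hU hp (Nat.zero_le k) A hA fun s hs => absurd hs (Nat.not_lt_zero _)
  rwa [kappa, colGroup_zero, antisymmetrizer_bot] at this

end Pairing

/-- The filtration piece `F_i` is contained in any subrepresentation that contains the images of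
the Specht modules for `j ≤ i`. -/
theorem F_le_of_map_spechtImage_le {n k i : ℕ} (hik : i ≤ k) (p : ∀ j ≤ i, Pairing n j)
    {N : Submodule ℚ (Finset (Fin n) →₀ ℚ)} (hN : ∀ g, ∀ v ∈ N, LPow n g v ∈ N)
    (h : ∀ j hj, (p j hj).spechtImage.map (upMap n k) ≤ N) : (F n k i).toSubmodule ≤ N := by
  have hN' : ∀ g, ∀ v ∈ N.comap (upMap n k), LPow n g v ∈ N.comap (upMap n k) := fun g v hv => by
    rw [Submodule.mem_comap] at hv ⊢
    rw [upMap_LPow]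
    exact hN g _ hv
  have hp : ∀ j hj, (p j hj).poly ∈ N.comap (upMap n k) := fun j hj =>
    h j hj (Submodule.mem_map_of_mem (p j hj).poly_mem_spechtImage)
  induction i with
  | zero =>
    rw [F_eq_map, Submodule.map_le_iff_le_comap]
    exact (p 0 le_rfl).LP_le hN' (fun A hA => absurd hA (Nat.succ_ne_zero _)) (hp 0 le_rfl)
  | succ i ih =>
    have hF := ih (by omega) (fun j hj => p j (by omega)) (fun j hj => h j (by omega))
      (fun j hj => hp j (by omega))
    rw [F_eq_map, Submodule.map_le_iff_le_comap]
    refine (p (i + 1) le_rfl).LP_le hN' (fun A hA => hF (map_upMap_F_succ hik ?_))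
      (hp (i + 1) le_rfl)
    exact Submodule.mem_map_of_mem (Submodule.subset_span ⟨A, by omega, rfl⟩)

theorem map_spechtImage_le_F {n k i j : ℕ} (hji : j ≤ i) (hik : i ≤ k) (p : Pairing n j) :
    p.spechtImage.map (upMap n k) ≤ (F n k i).toSubmodule := by
  refine le_trans ?_ (F_mono hji hik)
  rw [F_eq_map]
  exact Submodule.map_mono p.spechtImage_le_LP

/-! ### Tabloids with two rows as subsets -/

section TwoRow

variable {n j : ℕ} {h : 2 * j ≤ n}

theorem mem_twoRow {c : ℕ × ℕ} :
    c ∈ twoRow n j h ↔ c.1 = 0 ∧ c.2 < n - j ∨ c.1 = 1 ∧ c.2 < j := by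
  rw [twoRow, YoungDiagram.mem_ofRowLens]
  obtain ⟨_ | _ | r, c⟩ := c <;> simp

theorem rowLen_twoRow {r : ℕ} (hr : 2 ≤ r) : (twoRow n j h).rowLen r = 0 := by
  rw [YoungDiagram.rowLen_eq_card, Finset.card_eq_zero, Finset.eq_empty_iff_forall_notMem]
  intro c hc
  rw [YoungDiagram.mem_row_iff, mem_twoRow] at hc
  omega

/-- The entries of the second row of a tabloid. -/
def Tabloid.secondRow {μ : YoungDiagram} (f : Tabloid n μ) : Finset (Fin n) :=
  Finset.univ.filter fun x => f.1 x = 1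

theorem Tabloid.secondRow_smul {μ : YoungDiagram} (g : Perm (Fin n)) (f : Tabloid n μ) :
    (g • f).secondRow = g • f.secondRow := by
  ext x
  rw [← Finset.inv_smul_mem_iff, secondRow, secondRow, Finset.mem_filter, Finset.mem_filter]
  exact and_congr_left' (by simp)

theorem Tabloid.lt_two (f : Tabloid n (twoRow n j h)) (x : Fin n) : f.1 x < 2 := by
  by_contra hx
  have := f.2 (f.1 x)
  rw [rowLen_twoRow (not_lt.1 hx), Finset.card_eq_zero] at this
  have hx : x ∈ (∅ : Finset (Fin n)) := this ▸ Finset.mem_filter.2 ⟨Finset.mem_univ x, rfl⟩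
  simp at hx

theorem Tabloid.secondRow_injective :
    Function.Injective (Tabloid.secondRow : Tabloid n (twoRow n j h) → Finset (Fin n)) := by
  intro f f' hff
  refine Subtype.ext (funext fun x => ?_)
  have h1 := f.lt_two x
  have h2 := f'.lt_two x
  have h3 : f.1 x = 1 ↔ f'.1 x = 1 := by
    simpa [secondRow] using Finset.ext_iff.1 hff x
  omega

variable (n j h) in
/-- The embedding of the permutation module on tabloids into the span of the power set. -/
def tabloidMap : (Tabloid n (twoRow n j h) →₀ ℚ) →ₗ[ℚ] (Finset (Fin n) →₀ ℚ) :=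
  Finsupp.lmapDomain ℚ ℚ Tabloid.secondRow

theorem tabloidMap_single (f : Tabloid n (twoRow n j h)) (c : ℚ) :
    tabloidMap n j h (Finsupp.single f c) = Finsupp.single f.secondRow c := by
  simp [tabloidMap]

theorem tabloidMap_injective : Function.Injective (tabloidMap n j h) :=
  Finsupp.mapDomain_injective Tabloid.secondRow_injective

theorem tabloidMap_linearization (g : Perm (Fin n)) (v : Tabloid n (twoRow n j h) →₀ ℚ) :
    tabloidMap n j h (linearization _ _ g v) = LPow n g (tabloidMap n j h v) := by
  induction v using Finsupp.induction_linear with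
  | zero => simp
  | add v w hv hw => simp only [map_add, hv, hw]
  | single f c => rw [linearization_single, tabloidMap_single, tabloidMap_single,
      linearization_single, Tabloid.secondRow_smul]

namespace Tableau

variable (T : Tableau n (twoRow n j h))

theorem mem_cells_zero (r : Fin j) : ((0, r.1) : ℕ × ℕ) ∈ (twoRow n j h).cells :=
  (YoungDiagram.mem_cells _).2 (mem_twoRow.2 (Or.inl ⟨rfl, by have := r.2; dsimp only; omega⟩))

theorem mem_cells_one (r : Fin j) : ((1, r.1) : ℕ × ℕ) ∈ (twoRow n j h).cells :=
  (YoungDiagram.mem_cells _).2 (mem_twoRow.2 (Or.inr ⟨rfl, r.2⟩))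

theorem row_col_mem (x : Fin n) :
    T.row x = 0 ∧ T.col x < n - j ∨ T.row x = 1 ∧ T.col x < j :=
  mem_twoRow.1 ((YoungDiagram.mem_cells _).1 (T.symm x).2)

theorem eq_apply {x : Fin n} {c : ℕ × ℕ} (hc : c ∈ (twoRow n j h).cells) (h1 : T.row x = c.1)
    (h2 : T.col x = c.2) : x = T ⟨c, hc⟩ :=
  T.symm_apply_eq.1 (Subtype.ext (Prod.ext h1 h2))

/-- The columns of a tableau with two rows. -/
def pairing : Pairing n j where
  col := T.col
  a r := T ⟨(0, r), mem_cells_zero r⟩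
  b r := T ⟨(1, r), mem_cells_one r⟩
  col_a r := by simp [col]
  col_b r := by simp [col]
  a_ne_b r := by simp
  eq_or_eq {x r} hx := (T.row_col_mem x).imp (fun h => T.eq_apply _ h.1 hx)
    fun h => T.eq_apply _ h.1 hx

theorem secondRow_tabloid : T.tabloid.secondRow = T.pairing.bottom := by
  ext x
  simp only [Tabloid.secondRow, Pairing.bottom, Finset.mem_filter, Finset.mem_image,
    Finset.mem_univ, true_and]
  constructor
  · intro hx
    have hc : T.col x < j := by
      rcases T.row_col_mem x with h | h
      · exact absurd (h.1.symm.trans hx) zero_ne_one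
      · exact h.2
    exact ⟨⟨T.col x, hc⟩, (T.eq_apply (c := (1, T.col x)) _ hx rfl).symm⟩
  · rintro ⟨r, rfl⟩
    change (T.symm (T _)).1.1 = 1
    rw [Equiv.symm_apply_apply]

theorem mem_colStab_iff {g : Perm (Fin n)} : g ∈ T.colStab ↔ g ∈ T.pairing.colGroup j := by
  rw [colStab, Finset.mem_filter, Pairing.mem_colGroup]
  refine ⟨fun hg x => ⟨hg.2 x, fun hx => ?_⟩, fun hg => ⟨Finset.mem_univ _, fun x => (hg x).1⟩⟩
  have hx' : j ≤ T.col x := hx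
  have h0 := hg.2 x
  have h1 := T.row_col_mem x
  have h2 := T.row_col_mem (g x)
  exact T.symm.injective (Subtype.ext (Prod.ext (show T.row (g x) = T.row x by omega) h0))

theorem tabloidMap_polytabloid : tabloidMap n j h T.polytabloid = T.pairing.poly := by
  classical
  rw [polytabloid, map_sum, Pairing.poly, Pairing.kappa, antisymmetrizer_apply,
    ← Finset.sum_filter]
  refine Finset.sum_congr ?_ fun g _ => ?_
  · ext g
    rw [T.mem_colStab_iff]
    simp
  · rw [tabloidMap_single, Tabloid.secondRow_smul, secondRow_tabloid, linearization_single,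
      Finsupp.smul_single, smul_eq_mul, mul_one]

theorem map_specht :
    (specht n (twoRow n j h)).toSubmodule.map (tabloidMap n j h) = T.pairing.spechtImage := by
  change (Submodule.span ℚ _).map _ = Submodule.span ℚ _
  rw [Submodule.map_span, ← Set.range_comp]
  congr 1
  ext v
  constructor
  · rintro ⟨T', rfl⟩
    refine ⟨T.symm.trans T', ?_⟩
    simp only [Function.comp]
    rw [← T.tabloidMap_polytabloid, ← tabloidMap_linearization, linearization_polytabloid]
    congr 2
    ext x
    simp
  · rintro ⟨g, rfl⟩
    refine ⟨T.trans g, ?_⟩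
    simp only [Function.comp]
    rw [← T.tabloidMap_polytabloid, ← tabloidMap_linearization, linearization_polytabloid]

end Tableau

variable (n j h)

/-- A tableau of shape `(n - j, j)`. -/
def someTableau : Tableau n (twoRow n j h) :=
  Fintype.equivFinOfCardEq (by rw [Fintype.card_coe]; exact twoRow_card n j h)

/-- The columns of a tableau of shape `(n - j, j)`. -/
def somePairing : Pairing n j := (someTableau n j h).pairing

/-- The embedding of `V_{(n-j,j)}` into the span of the power set. -/
def spechtMap : (specht n (twoRow n j h)).toSubmodule →ₗ[ℚ] (Finset (Fin n) →₀ ℚ) :=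
  (tabloidMap n j h).domRestrict _

variable {n j h}

theorem spechtMap_injective : Function.Injective (spechtMap n j h) :=
  tabloidMap_injective.comp Subtype.val_injective

theorem range_spechtMap : LinearMap.range (spechtMap n j h) = (somePairing n j h).spechtImage := by
  rw [spechtMap, LinearMap.range_domRestrict, (someTableau n j h).map_specht, somePairing]

theorem spechtMap_mem (v : (specht n (twoRow n j h)).toSubmodule) :
    spechtMap n j h v ∈ (somePairing n j h).spechtImage :=
  range_spechtMap (h := h) ▸ LinearMap.mem_range_self _ v

theorem spechtMap_V (g : Perm (Fin n)) (v : (specht n (twoRow n j h)).toSubmodule) :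
    spechtMap n j h (V n j h g v) = LPow n g (spechtMap n j h v) :=
  tabloidMap_linearization g v.1

/-- A vector of `V_{(n-j,j)}` all of whose translates are killed by the signed column sum is
zero. -/
theorem eq_zero_of_antisymmetrizer (v : (specht n (twoRow n j h)).toSubmodule)
    (hv : ∀ g, antisymmetrizer (V n j h) ((somePairing n j h).colGroup j) (V n j h g v) = 0) :
    v = 0 := by
  refine spechtMap_injective (Eq.trans ?_ (map_zero _).symm)
  refine (somePairing n j h).eq_zero_of_kappa (spechtMap_mem v) fun g => ?_
  rw [Pairing.kappa, ← spechtMap_V, ← map_antisymmetrizer _ spechtMap_V, hv, map_zero]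

theorem nontrivial_specht : Nontrivial (specht n (twoRow n j h)).toSubmodule := by
  have h1 : (somePairing n j h).poly ∈ LinearMap.range (spechtMap n j h) := by
    rw [range_spechtMap]
    exact (somePairing n j h).poly_mem_spechtImage
  obtain ⟨v, hv⟩ := h1
  refine ⟨v, 0, ?_⟩
  rintro rfl
  exact (somePairing n j h).poly_ne_zero h (by rw [← hv, map_zero])

theorem isIrreducible_V : (V n j h).IsIrreducible := by
  have := nontrivial_specht (h := h)
  have hbt : (⊥ : Subrepresentation (V n j h)) ≠ ⊤ := fun hbt =>
    bot_ne_top (congrArg Subrepresentation.toSubmodule hbt)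
  refine { exists_pair_ne := ⟨_, _, hbt⟩, eq_bot_or_eq_top := fun N => ?_ }
  by_cases hN : N.toSubmodule = ⊥
  · exact Or.inl (Subrepresentation.toSubmodule_injective hN)
  · right
    obtain ⟨v, hvN, hv⟩ := Submodule.exists_mem_ne_zero_of_ne_bot hN
    have hle := (somePairing n j h).spechtImage_le_of_ne_zero
      (N := N.toSubmodule.map (spechtMap n j h))
      (by
        rintro g _ ⟨w, hw, rfl⟩
        exact ⟨V n j h g w, N.apply_mem_toSubmodule g hw, spechtMap_V g w⟩)
      (Submodule.mem_map_of_mem hvN) (spechtMap_mem v)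
      fun h0 => hv (spechtMap_injective (h0.trans (map_zero _).symm))
    refine Subrepresentation.toSubmodule_injective (eq_top_iff.2 fun w _ => ?_)
    obtain ⟨w', hw', hww⟩ := hle (spechtMap_mem w)
    rwa [← spechtMap_injective hww]

end TwoRow

theorem not_lt_of_equiv {n j l : ℕ} {hj : 2 * j ≤ n} {hl : 2 * l ≤ n}
    (f : (V n j hj).Equiv (V n l hl)) : ¬ j < l := by
  intro hjl
  have := nontrivial_specht (h := hl)
  obtain ⟨v, hv⟩ := exists_ne (0 : (specht n (twoRow n l hl)).toSubmodule)
  refine hv (eq_zero_of_antisymmetrizer v fun g => ?_)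
  have hf : ∀ g v, f.toLinearEquiv.toLinearMap (V n j hj g v) =
      V n l hl g (f.toLinearEquiv.toLinearMap v) := fun g v =>
    f.toIntertwiningMap.isIntertwining _ _ g v
  obtain ⟨w, rfl⟩ := f.toLinearEquiv.surjective v
  have h0 : antisymmetrizer (V n j hj) ((somePairing n l hl).colGroup l) (V n j hj g w) = 0 := by
    refine spechtMap_injective (Eq.trans ?_ (map_zero _).symm)
    rw [map_antisymmetrizer _ spechtMap_V]
    exact (somePairing n l hl).kappa_eq_zero hjl
      ((somePairing n j hj).spechtImage_le_LP (spechtMap_mem _))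
  have h1 := map_antisymmetrizer ((somePairing n l hl).colGroup l) hf (V n j hj g w)
  rw [h0, map_zero, hf] at h1
  exact h1.symm

/-! ### The decomposition -/

section Decomposition

theorem toModule_eq_sum {ι N : Type} [Fintype ι] [DecidableEq ι] {M : ι → Type}
    [∀ j, AddCommGroup (M j)] [∀ j, Module ℚ (M j)] [AddCommGroup N] [Module ℚ N]
    (f : ∀ j, M j →ₗ[ℚ] N) (v : ⨁ j, M j) :
    DirectSum.toModule ℚ ι N f v = ∑ j, f j (v j) := by
  conv_lhs => rw [← DirectSum.sum_univ_of v, map_sum]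
  exact Finset.sum_congr rfl fun j _ => DirectSum.toModule_lof ℚ j (v j)

theorem two_mul_val_le {n i : ℕ} (h : 2 * i ≤ n) (j : Fin (i + 1)) : 2 * j.1 ≤ n := by
  omega

variable (n k i : ℕ) (h : 2 * i ≤ n)

/-- The map from `V_{(n)} ⊕ … ⊕ V_{(n-i,i)}` to the span of the `k`-element subsets. -/
def sumMap : (⨁ j : Fin (i + 1), (specht n (twoRow n j.1 (two_mul_val_le h j))).toSubmodule) →ₗ[ℚ]
    (Finset (Fin n) →₀ ℚ) :=
  DirectSum.toModule ℚ _ _ fun j => upMap n k ∘ₗ spechtMap n j.1 (two_mul_val_le h j)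

variable {n k i h}

theorem sumMap_apply
    (v : ⨁ j : Fin (i + 1), (specht n (twoRow n j.1 (two_mul_val_le h j))).toSubmodule) :
    sumMap n k i h v = ∑ j, upMap n k (spechtMap n j.1 (two_mul_val_le h j) (v j)) :=
  toModule_eq_sum _ v

theorem sumMap_lof (j : Fin (i + 1))
    (v : (specht n (twoRow n j.1 (two_mul_val_le h j))).toSubmodule) :
    sumMap n k i h (DirectSum.lof ℚ (Fin (i + 1))
      (fun j => (specht n (twoRow n j.1 (two_mul_val_le h j))).toSubmodule) j v) =
        upMap n k (spechtMap n j.1 (two_mul_val_le h j) v) := by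
  rw [sumMap, DirectSum.toModule_lof, LinearMap.comp_apply]

theorem sumMap_sumV (g : Perm (Fin n)) :
    sumMap n k i h ∘ₗ sumV n i h g = LPow n g ∘ₗ sumMap n k i h := by
  refine DirectSum.linearMap_ext _ fun j => LinearMap.ext fun v => ?_
  simp only [LinearMap.comp_apply]
  rw [sumMap_lof, ← upMap_LPow, ← spechtMap_V, ← sumMap_lof (h := h)]
  congr 1
  exact DirectSum.lmap_lof _ _ _

theorem range_sumMap (hik : i ≤ k) :
    LinearMap.range (sumMap n k i h) = (F n k i).toSubmodule := by
  apply le_antisymm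
  · rintro _ ⟨v, rfl⟩
    induction v using DirectSum.induction_on with
    | zero => simp
    | of j v =>
      change sumMap n k i h (DirectSum.lof ℚ _ _ j v) ∈ _
      rw [sumMap_lof]
      exact map_spechtImage_le_F (Nat.lt_succ_iff.1 j.2) hik _
        (Submodule.mem_map_of_mem (spechtMap_mem v))
    | add v w hv hw =>
      rw [map_add]
      exact Submodule.add_mem _ hv hw
  · refine F_le_of_map_spechtImage_le hik (fun j hj => somePairing n j (by omega)) ?_ ?_
    · rintro g _ ⟨v, rfl⟩
      exact ⟨sumV n i h g v, LinearMap.congr_fun (sumMap_sumV g) v⟩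
    · rintro j hj _ ⟨v, hv, rfl⟩
      have hv' : v ∈ (somePairing n j (by omega)).spechtImage := hv
      rw [← range_spechtMap] at hv'
      obtain ⟨w, rfl⟩ := hv'
      exact ⟨_, sumMap_lof ⟨j, Nat.lt_succ_iff.2 hj⟩ w⟩

theorem sumMap_injective (hik : i ≤ k) (hk : k + i ≤ n) :
    Function.Injective (sumMap n k i h) := by
  rw [injective_iff_map_eq_zero]
  intro v hv
  have key : ∀ d : ℕ, ∀ j : Fin (i + 1), i - j.1 < d → v j = 0 := by
    intro d
    induction d with
    | zero => exact fun j hj => absurd hj (Nat.not_lt_zero _)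
    | succ d ih =>
      intro j hj
      have hj2 : 2 * j.1 ≤ n := by omega
      refine spechtMap_injective (Eq.trans ?_ (map_zero _).symm)
      refine (somePairing n j.1 hj2).eq_zero_of_kappa (spechtMap_mem (v j)) fun g => ?_
      refine (somePairing n j.1 hj2).upMap_injOn (l := k) (by omega) (by omega)
        (antisymmetrizer_mem _ _ (fun g v => (somePairing n j.1 hj2).LPow_mem_spechtImage g)
          ((somePairing n j.1 hj2).LPow_mem_spechtImage g (spechtMap_mem (v j)))) ?_
      have h0 : (somePairing n j.1 hj2).kappa j.1 (LPow n g (sumMap n k i h v)) = 0 := by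
        rw [hv, map_zero, map_zero]
      rw [sumMap_apply, map_sum, map_sum, Finset.sum_eq_single j] at h0
      · rw [← upMap_LPow, Pairing.kappa, ← map_antisymmetrizer _ upMap_LPow] at h0
        exact h0
      · intro l _ hlj
        have hl2 : 2 * l.1 ≤ n := by omega
        rw [← upMap_LPow, Pairing.kappa, ← map_antisymmetrizer _ upMap_LPow]
        rcases lt_or_gt_of_ne hlj with hlt | hgt
        · have := (somePairing n j.1 hj2).kappa_eq_zero hlt
            ((LP n l.1).apply_mem_toSubmodule g
              ((somePairing n l.1 hl2).spechtImage_le_LP (spechtMap_mem (v l))))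
          rw [Pairing.kappa] at this
          rw [this, map_zero]
        · rw [ih l (by have : j.1 < l.1 := hgt; omega)]
          simp only [map_zero]
      · simp
  ext1 j
  exact key (i + 1) j (by omega)

/-- A subrepresentation that has `F_i LP_k(n)` as its underlying space is the direct sum of the
`V_{(n-j,j)}` for `j ≤ i`. -/
theorem nonempty_equiv_sumV (hik : i ≤ k) (hk : k + i ≤ n) (L : Subrepresentation (LPow n))
    (hL : L.toSubmodule = (F n k i).toSubmodule) :
    Nonempty (L.toRepresentation.Equiv (sumV n i h)) := by
  let e := (LinearEquiv.ofInjective _ (sumMap_injective (h := h) hik hk)).trans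
    (LinearEquiv.ofEq _ _ ((range_sumMap hik).trans hL.symm))
  have he : ∀ g, e.toLinearMap ∘ₗ sumV n i h g = L.toRepresentation g ∘ₗ e.toLinearMap := fun g =>
    LinearMap.ext fun v => Subtype.ext (LinearMap.congr_fun (sumMap_sumV (k := k) g) v)
  exact ⟨(Representation.Equiv.mk e he).symm⟩

end Decomposition

end PowerSetRep

end

theorem proposition2p6 (n k i : ℕ) (hik : i ≤ k) (hk : 2 * k ≤ n) :
    -- the summands are irreducible and pairwise non-isomorphic
    (∀ (j : ℕ) (hj : j ≤ k), (PowerSetRep.V n j (by omega)).IsIrreducible) ∧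
    (∀ (j l : ℕ) (hj : j ≤ k) (hl : l ≤ k),
      Nonempty ((PowerSetRep.V n j (by omega)).Equiv (PowerSetRep.V n l (by omega))) → j = l) ∧
    -- the decompositions of `LP_k(n)` and of `F_i LP_k(n)`
    Nonempty ((PowerSetRep.LP n k).toRepresentation.Equiv (PowerSetRep.sumV n k hk)) ∧
    Nonempty ((PowerSetRep.F n k i).toRepresentation.Equiv
      (PowerSetRep.sumV n i (by omega))) := by
  refine ⟨fun j hj => PowerSetRep.isIrreducible_V, fun j l hj hl ⟨f⟩ => ?_,
    PowerSetRep.nonempty_equiv_sumV le_rfl (by omega) _ PowerSetRep.F_self.symm,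
    PowerSetRep.nonempty_equiv_sumV hik (by omega) _ rfl⟩
  exact le_antisymm (not_lt.1 (PowerSetRep.not_lt_of_equiv f.symm))
    (not_lt.1 (PowerSetRep.not_lt_of_equiv f))
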